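/- **Quantile-based persuasion.** Let $\mathcal F_0$ be the set of cumulative distribution functions on $\mathbb R$ (identified with the probability measures on $\mathbb R$), let $F\in\mathcal F_0$ have full support on some interval, and let $\tau\in(0,1)$. For $G\in\mathcal F_0$ and $q\in(0,1)$ let $G^{-1}(q)=\inf\{x: G(x)\ge q\}$, and let $G^{-1}(\tau^+)=\lim_{q\downarrow\tau}G^{-1}(q)$. A $\tau$-quantile selection rule is a transition probability $r$ from $\mathcal F_0$ to $\mathbb R$ such that $r(\cdot\mid G)$ assigns probability one to $[G^{-1}(\tau),G^{-1}(\tau^+)]$ for every $G\in\mathcal F_0$. Suppose that $r$ is a $\tau$-quantile selection rule, that $v_S:\mathbb R\to\mathbb R$ is measurable and integrable with respect to $r(\cdot\mid G)$ for every $G\in\mathcal F_0$, and that the sender's indirect utility $\hat v:\mathcal F_0\to\mathbb R$ is given by $$\hat v(G)=\int_{\mathbb R}v_S(x)\,r(dx\mid G)\qquad\text{for all }G\in\mathcal F_0 .$$ Let $F_L^\tau(\omega)=\min\{F(\omega)/\tau,\,1\}$ and $F_R^\tau(\omega)=\max\{(F(\omega)-\tau)/(1-\tau),\,0\}$, and let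 $\mathcal I(F_R^\tau,F_L^\tau)$ be the set of nondecreasing right-continuous functions $H:\mathbb R\to\mathbb R$ with $F_R^\tau\le H\le F_L^\tau$ pointwise. Let $$\mathrm{cav}(\hat v)[F]=\sup\{z\in\mathbb R:\ (F,z)\in\mathrm{co}(\mathrm{graph}\,\hat v)\}$$ be the concave closure of $\hat v$ at $F$, where $\mathrm{co}$ denotes the convex hull. Let $\mathcal M$ be the set of signals for $F$, that is, of probability measures $\mu$ on $\mathcal F_0$ with $\int G(\omega)\,\mu(dG)=F(\omega)$ for all $\omega\in\mathbb R$. Then $$\mathrm{cav}(\hat v)[F]\;=\;\sup_{\mu\in\mathcal M}\int_{\mathcal F_0}\hat v(G)\,\mu(dG)\;=\;\sup_{H\in\mathcal I(F_R^\tau,F_L^\tau)}\int_{\mathbb R}v_S(\omega)\,H(d\omega).$$ All suprema are taken in the extended reals; an integral $\int f$ means $\int f^+-\int f^-$, and those $\mu$ and $H$ for which it is undefined ($\infty-\infty$) are disregarded. -/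

import Mathlib

open MeasureTheory ProbabilityTheory

/-- `F` has full support on the set `J`: all the mass of `F` is on `J`, and every nonempty
relatively open subset of `J` has positive mass. -/
def HasFullSupportOn (F : Measure ℝ) (J : Set ℝ) : Prop :=
  F J = 1 ∧ ∀ U : Set ℝ, IsOpen U → (U ∩ J).Nonempty → 0 < F (U ∩ J)

/-- The quantile function `G⁻¹(q) = inf {x | G(x) ≥ q}`, for `q ∈ (0, 1)`. A CDF is represented by
the probability measure on `ℝ` that it determines; the CDF itself is `cdf G`. -/
noncomputable def quantile (G : ProbabilityMeasure ℝ) (q : ℝ) : ℝ :=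
  sInf {x : ℝ | q ≤ cdf (G : Measure ℝ) x}

/-- The set `[G⁻¹(τ), G⁻¹(τ⁺)]` of `τ`-quantiles of `G`, for `τ ∈ (0, 1)`. -/
noncomputable def quantileSet (τ : ℝ) (G : ProbabilityMeasure ℝ) : Set ℝ :=
  Set.Icc (quantile G τ) (Function.rightLim (quantile G) τ)

/-- A `τ`-quantile selection rule: a transition probability from CDFs to `ℝ` that, for every `G`,
puts probability one on the set of `τ`-quantiles of `G`. -/
def IsQuantileSelectionRule (τ : ℝ) (r : Kernel (ProbabilityMeasure ℝ) ℝ) : Prop :=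
  IsMarkovKernel r ∧ ∀ G : ProbabilityMeasure ℝ, r G (quantileSet τ G) = 1

/-- A signal for the prior `F`: a probability distribution over posteriors that average to `F`. -/
def IsSignal (F : ProbabilityMeasure ℝ) (μ : Measure (ProbabilityMeasure ℝ)) : Prop :=
  IsProbabilityMeasure μ ∧
    ∀ ω : ℝ, ∫ G : ProbabilityMeasure ℝ, cdf (G : Measure ℝ) ω ∂μ = cdf (F : Measure ℝ) ω

/-- The left-truncation `F_L^τ(ω) = min {F(ω) / τ, 1}`. -/
noncomputable def leftTruncation (τ : ℝ) (F : ProbabilityMeasure ℝ) (ω : ℝ) : ℝ :=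
  min (1 / τ * cdf (F : Measure ℝ) ω) 1

/-- The right-truncation `F_R^τ(ω) = max {(F(ω) - τ) / (1 - τ), 0}`. -/
noncomputable def rightTruncation (τ : ℝ) (F : ProbabilityMeasure ℝ) (ω : ℝ) : ℝ :=
  max ((cdf (F : Measure ℝ) ω - τ) / (1 - τ)) 0

/-- The interval of nondecreasing right-continuous functions lying pointwise between two given
functions. -/
def monotoneInterval (lower upper : ℝ → ℝ) : Set (StieltjesFunction ℝ) :=
  {H | ∀ x : ℝ, lower x ≤ H x ∧ H x ≤ upper x}

/-- The integral with values in the extended reals, `∫ f⁺ dμ - ∫ f⁻ dμ`. In `EReal` one has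
`⊤ - ⊤ = ⊥`, so an undefined integral counts as `-∞` and never contributes to a supremum that
ranges over at least one measure with a well-defined integral. -/
noncomputable def extIntegral {α : Type*} [MeasurableSpace α] (f : α → ℝ) (μ : Measure α) : EReal :=
  ((∫⁻ x, ENNReal.ofReal (f x) ∂μ : ENNReal) : EReal) -
    ((∫⁻ x, ENNReal.ofReal (-f x) ∂μ : ENNReal) : EReal)

/-- The concave closure of `w` at `F`: the supremum of all `z` such that `(F, z)` lies in the convex
hull of the graph of `w`, where the domain of `w` is the convex set of CDFs in the vector space of
functions `ℝ → ℝ`. -/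
noncomputable def concaveClosure (w : ProbabilityMeasure ℝ → ℝ) (F : ProbabilityMeasure ℝ) :
    EReal :=
  ⨆ (z : ℝ) (_ : ((cdf (F : Measure ℝ) : ℝ → ℝ), z) ∈ convexHull ℝ
    (Set.range fun G : ProbabilityMeasure ℝ => ((cdf (G : Measure ℝ) : ℝ → ℝ), w G))), (z : EReal)

/-- The value of persuasion with indirect utility `w` at the prior `F`: the supremum, over all
signals, of the expectation of `w` under the distribution of posteriors. -/
noncomputable def persuasionValue (w : ProbabilityMeasure ℝ → ℝ) (F : ProbabilityMeasure ℝ) :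
    EReal :=
  ⨆ (μ : Measure (ProbabilityMeasure ℝ)) (_ : IsSignal F μ), extIntegral w μ

/-!
Since `vHat G` is the integral of `vS` against the selected quantile `r G`, averaging `r` over a
signal gives a law of quantiles, and averaging the bounds of `cdf (r G)` by the two truncations of
the posterior `G` shows that this law lies between the two truncations of the prior. Points of the
convex hull of the graph are signals with finite support, so it remains to bound `∫ vS dP` by the
concave closure for every `P` between the truncations.

For such a `P` and `u ∈ (0, 1)`, the bounds on the quantile function say that `F` crosses some
level `v ∈ [τ u, τ + (1 - τ) u]` exactly at `x = P⁻¹(u)`. A posterior that takes a slice of `F` at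
level `τ u` with weight `τ` and a slice at level `τ + (1 - τ) u` with weight `1 - τ` has `x` among
its `τ`-quantiles, and over `u ∈ (0, 1)` these slices exhaust `F`. Discretizing `u` turns this into
convex combinations whose values approximate `∫ vS (P⁻¹(u)) du = ∫ vS dP`. The selection rule is
arbitrary, so each posterior is perturbed until `x` is its only `τ`-quantile.
-/

open Set Filter Topology

/-- `g` crosses the level `q` at `x` and nowhere else. A CDF does so exactly when `x` is its only
`q`-quantile. -/
def CrossesAt (g : ℝ → ℝ) (q x : ℝ) : Prop :=
  (∀ y < x, g y < q) ∧ ∀ y > x, q < g y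

theorem CrossesAt.comp {φ g : ℝ → ℝ} {τ v x : ℝ} (hφ : CrossesAt φ τ v) (hg : CrossesAt g v x) :
    CrossesAt (φ ∘ g) τ x :=
  ⟨fun y hy => hφ.1 _ (hg.1 y hy), fun y hy => hφ.2 _ (hg.2 y hy)⟩

section Quantile

variable (G : ProbabilityMeasure ℝ) {q τ x : ℝ}

theorem quantile_le_iff (hq : q ∈ Ioo (0 : ℝ) 1) :
    quantile G q ≤ x ↔ q ≤ cdf (G : Measure ℝ) x := by
  have hmono := monotone_cdf (G : Measure ℝ)
  have hne : {x : ℝ | q ≤ cdf (G : Measure ℝ) x}.Nonempty := by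
    obtain ⟨y, hy⟩ := ((tendsto_cdf_atTop (G : Measure ℝ)).eventually (lt_mem_nhds hq.2)).exists
    exact ⟨y, hy.le⟩
  have hbdd : BddBelow {x : ℝ | q ≤ cdf (G : Measure ℝ) x} := by
    obtain ⟨y, hy⟩ := ((tendsto_cdf_atBot (G : Measure ℝ)).eventually (gt_mem_nhds hq.1)).exists
    exact ⟨y, fun z hz => le_of_not_gt fun h => (hy.trans_le hz).not_ge (hmono h.le)⟩
  refine ⟨fun h => le_trans ?_ (hmono h), fun h => csInf_le hbdd h⟩
  have hright := ((cdf (G : Measure ℝ)).right_continuous (quantile G q)).mono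
    (Ioi_subset_Ici le_rfl)
  refine ge_of_tendsto hright ?_
  filter_upwards [self_mem_nhdsWithin] with y hy
  obtain ⟨z, hz, hzy⟩ := exists_lt_of_csInf_lt hne hy
  exact le_trans hz (hmono hzy.le)

theorem lt_quantile_iff (hq : q ∈ Ioo (0 : ℝ) 1) :
    x < quantile G q ↔ cdf (G : Measure ℝ) x < q := by
  rw [← not_le, quantile_le_iff G hq, not_le]

theorem monotoneOn_quantile : MonotoneOn (quantile G) (Ioo 0 1) := fun _ hp _ hq hpq =>
  (quantile_le_iff G hp).2 (hpq.trans ((quantile_le_iff G hq).1 le_rfl))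

theorem tendsto_quantile_rightLim (hτ : τ ∈ Ioo (0 : ℝ) 1) :
    Tendsto (quantile G) (𝓝[>] τ) (𝓝 (Function.rightLim (quantile G) τ)) := by
  have hsub : Ioo τ 1 ⊆ Ioo 0 1 := Ioo_subset_Ioo_left hτ.1.le
  have hbdd : BddBelow (quantile G '' Ioo τ 1) := by
    refine ⟨quantile G τ, ?_⟩
    rintro _ ⟨q, hq, rfl⟩
    exact monotoneOn_quantile G hτ (hsub hq) hq.1.le
  have h := ((monotoneOn_quantile G).mono hsub).tendsto_nhdsWithin_Ioo_right
    (nonempty_Ioo.2 hτ.2) hbdd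
  rwa [rightLim_eq_of_tendsto h]

theorem rightLim_quantile_le (hτ : τ ∈ Ioo (0 : ℝ) 1) (hx : τ < cdf (G : Measure ℝ) x) :
    Function.rightLim (quantile G) τ ≤ x := by
  refine le_of_tendsto (tendsto_quantile_rightLim G hτ) ?_
  filter_upwards [Ioo_mem_nhdsGT (lt_min hx hτ.2)] with q hq
  have hq' := lt_min_iff.1 hq.2
  exact (quantile_le_iff G ⟨hτ.1.trans hq.1, hq'.2⟩).2 hq'.1.le

variable {G} in
theorem CrossesAt.quantileSet_subset (hτ : τ ∈ Ioo (0 : ℝ) 1)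
    (hx : CrossesAt (cdf (G : Measure ℝ)) τ x) : quantileSet τ G ⊆ {x} := fun _ hz =>
  le_antisymm
    (hz.2.trans (le_of_forall_gt_imp_ge_of_dense fun y hy => rightLim_quantile_le G hτ (hx.2 y hy)))
    ((le_of_forall_lt_imp_le_of_dense fun y hy => ((lt_quantile_iff G hτ).2 (hx.1 y hy)).le).trans
      hz.1)

theorem aemeasurable_quantile : AEMeasurable (quantile G) (volume.restrict (Ioo 0 1)) :=
  aemeasurable_restrict_of_monotoneOn measurableSet_Ioo (monotoneOn_quantile G)

theorem map_quantile : (volume.restrict (Ioo 0 1)).map (quantile G) = G := by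
  have : IsFiniteMeasure ((volume.restrict (Ioo (0 : ℝ) 1)).map (quantile G)) :=
    Measure.isFiniteMeasure_map _ _
  refine Measure.ext_of_Iic _ _ fun x => ?_
  have hpre : quantile G ⁻¹' Iic x ∩ Ioo 0 1 = Iic (cdf (G : Measure ℝ) x) ∩ Ioo 0 1 :=
    ext fun u => and_congr_left fun hu => quantile_le_iff G hu
  rw [Measure.map_apply_of_aemeasurable (aemeasurable_quantile G) measurableSet_Iic,
    Measure.restrict_apply' measurableSet_Ioo, hpre, ← Measure.restrict_apply measurableSet_Iic,
    Measure.restrict_congr_set Ioo_ae_eq_Ioc, Measure.restrict_apply measurableSet_Iic, inter_comm,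
    Ioc_inter_Iic, min_eq_right (cdf_le_one _ _), Real.volume_Ioc, sub_zero, ofReal_cdf]

end Quantile

section FullSupport

variable {F : ProbabilityMeasure ℝ} {J : Set ℝ} {τ u v x y : ℝ}

theorem HasFullSupportOn.cdf_lt_cdf (hF : HasFullSupportOn (F : Measure ℝ) J)
    (hJ : J.OrdConnected) (hxy : x < y) (h0 : 0 < cdf (F : Measure ℝ) x)
    (h1 : cdf (F : Measure ℝ) x < 1) : cdf (F : Measure ℝ) x < cdf (F : Measure ℝ) y := by
  have hJ_ae : ∀ᵐ z ∂(F : Measure ℝ), z ∈ J := (mem_ae_iff_prob_eq_one hJ.measurableSet).2 hF.1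
  have exists_mem {s : Set ℝ} (hs : (F : Measure ℝ) s ≠ 0) : ∃ z ∈ s, z ∈ J :=
    ((frequently_ae_mem_iff.2 hs).and_eventually hJ_ae).exists
  have hIic : (F : Measure ℝ) (Iic x) ≠ 0 := by
    rw [← ofReal_cdf]
    exact (ENNReal.ofReal_pos.2 h0).ne'
  have hIoi : (F : Measure ℝ) (Ioi x) ≠ 0 := by
    rw [← compl_Iic, Ne, prob_compl_eq_zero_iff measurableSet_Iic, ← ofReal_cdf]
    exact (ENNReal.ofReal_lt_one.2 h1).ne
  obtain ⟨a, hax, haJ⟩ := exists_mem hIic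
  obtain ⟨b, hxb, hbJ⟩ := exists_mem hIoi
  obtain ⟨c, hxc, hcyb⟩ := exists_between (lt_min hxy hxb)
  obtain ⟨hcy, hcb⟩ := lt_min_iff.1 hcyb
  have hcJ : c ∈ J := hJ.out haJ hbJ ⟨(mem_Iic.1 hax).trans hxc.le, hcb.le⟩
  have hIoc : 0 < (F : Measure ℝ) (Ioc x y) :=
    (hF.2 _ isOpen_Ioo ⟨c, ⟨hxc, hcy⟩, hcJ⟩).trans_le
      (measure_mono (inter_subset_left.trans Ioo_subset_Ioc_self))
  rw [← measure_cdf (F : Measure ℝ), StieltjesFunction.measure_Ioc, ENNReal.ofReal_pos] at hIoc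
  exact sub_pos.1 hIoc

theorem HasFullSupportOn.crossesAt_cdf (hF : HasFullSupportOn (F : Measure ℝ) J)
    (hJ : J.OrdConnected) (hv : v ∈ Ioo (0 : ℝ) 1)
    (hx : v ∈ Icc (Function.leftLim (cdf (F : Measure ℝ)) x) (cdf (F : Measure ℝ) x)) :
    CrossesAt (cdf (F : Measure ℝ)) v x := by
  have hmono := monotone_cdf (F : Measure ℝ)
  refine ⟨fun y hy => ?_, fun y hy => ?_⟩
  · have hyv : cdf (F : Measure ℝ) y ≤ v := (hmono.le_leftLim hy).trans hx.1
    rcases (cdf_nonneg (F : Measure ℝ) y).eq_or_lt with h0 | h0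
    · exact h0 ▸ hv.1
    · obtain ⟨z, hyz, hzx⟩ := exists_between hy
      exact (hF.cdf_lt_cdf hJ hyz h0 (hyv.trans_lt hv.2)).trans_le
        ((hmono.le_leftLim hzx).trans hx.1)
  · rcases (cdf_le_one (F : Measure ℝ) x).lt_or_eq with h1 | h1
    · exact hx.2.trans_lt (hF.cdf_lt_cdf hJ hy (hv.1.trans_le hx.2) h1)
    · exact hv.2.trans_le (h1.ge.trans (hmono hy.le))

theorem HasFullSupportOn.crossesAt_quantile (hF : HasFullSupportOn (F : Measure ℝ) J)
    (hJ : J.OrdConnected) (hv : v ∈ Ioo (0 : ℝ) 1) :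
    CrossesAt (cdf (F : Measure ℝ)) v (quantile F v) := by
  refine hF.crossesAt_cdf hJ hv ⟨?_, (quantile_le_iff F hv).1 le_rfl⟩
  refine le_of_tendsto ((monotone_cdf _).tendsto_leftLim _) ?_
  filter_upwards [self_mem_nhdsWithin] with y hy using ((lt_quantile_iff F hv).1 hy).le

theorem HasFullSupportOn.exists_crossesAt (hF : HasFullSupportOn (F : Measure ℝ) J)
    (hJ : J.OrdConnected) (hτ : τ ∈ Ioo (0 : ℝ) 1) (hu : u ∈ Ioo (0 : ℝ) 1)
    (hx : τ * u ≤ cdf (F : Measure ℝ) x)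
    (hlt : ∀ y < x, cdf (F : Measure ℝ) y ≤ τ + (1 - τ) * u) :
    ∃ v ∈ Icc (τ * u) (τ + (1 - τ) * u), CrossesAt (cdf (F : Measure ℝ)) v x := by
  have hmono := monotone_cdf (F : Measure ℝ)
  have hpos : 0 < τ * u := mul_pos hτ.1 hu.1
  have hlt_one : τ + (1 - τ) * u < 1 := by nlinarith [hτ.2, hu.2]
  have hleft : Function.leftLim (cdf (F : Measure ℝ)) x ≤ τ + (1 - τ) * u :=
    le_of_tendsto (hmono.tendsto_leftLim x) (by
      filter_upwards [self_mem_nhdsWithin] with y hy using hlt y hy)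
  have hupper : max (τ * u) (Function.leftLim (cdf (F : Measure ℝ)) x) ≤ τ + (1 - τ) * u :=
    max_le (by nlinarith [hτ.2, hu.2, hτ.1, hu.1]) hleft
  exact ⟨_, ⟨le_max_left _ _, hupper⟩, hF.crossesAt_cdf hJ
    ⟨hpos.trans_le (le_max_left _ _), hupper.trans_lt hlt_one⟩
    ⟨le_max_right _ _, max_le hx (hmono.leftLim_le le_rfl)⟩⟩

end FullSupport

section Distortion

/-- Continuous probability distortions. They turn the CDF `F` of a prior into CDFs `φ ∘ F`, so that
an average of distortions equal to the identity is a decomposition of the prior into posteriors. -/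
def distortions : Set (ℝ → ℝ) :=
  {φ | Continuous φ ∧ Monotone φ ∧ φ 0 = 0 ∧ φ 1 = 1}

theorem convex_distortions : Convex ℝ distortions := by
  rintro φ ⟨hφc, hφm, hφ0, hφ1⟩ ψ ⟨hψc, hψm, hψ0, hψ1⟩ a b ha hb hab
  refine ⟨(hφc.const_smul a).add (hψc.const_smul b),
    (hφm.const_mul ha).add (hψm.const_mul hb), ?_, ?_⟩
  · simp [hφ0, hψ0]
  · simp [hφ1, hψ1, hab]

theorem exists_cdf_eq_distortion_comp (F : ProbabilityMeasure ℝ) {φ : ℝ → ℝ}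
    (hφ : φ ∈ distortions) :
    ∃ G : ProbabilityMeasure ℝ, (cdf (G : Measure ℝ) : ℝ → ℝ) = φ ∘ cdf (F : Measure ℝ) := by
  obtain ⟨hc, hm, h0, h1⟩ := hφ
  let S : StieltjesFunction ℝ :=
    { toFun := φ ∘ cdf (F : Measure ℝ)
      mono' := hm.comp (monotone_cdf _)
      right_continuous' := fun x =>
        hc.continuousAt.comp_continuousWithinAt ((cdf (F : Measure ℝ)).right_continuous x) }
  have hbot : Tendsto S atBot (𝓝 0) := by
    simpa only [h0] using (hc.tendsto 0).comp (tendsto_cdf_atBot (F : Measure ℝ))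
  have htop : Tendsto S atTop (𝓝 1) := by
    simpa only [h1] using (hc.tendsto 1).comp (tendsto_cdf_atTop (F : Measure ℝ))
  exact ⟨⟨S.measure, S.isProbabilityMeasure hbot htop⟩,
    congrArg StieltjesFunction.toFun (cdf_measure_stieltjesFunction S hbot htop)⟩

theorem CrossesAt.mixture {φ σ : ℝ → ℝ} {τ v ε : ℝ} (hσ : CrossesAt σ τ v) (hφ : Monotone φ)
    (hφv : φ v = τ) (hε : ε ∈ Ioo (0 : ℝ) 1) : CrossesAt ((1 - ε) • φ + ε • σ) τ v := by
  refine ⟨fun y hy => ?_, fun y hy => ?_⟩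
  · have h := hφ hy.le
    simp only [Pi.add_apply, Pi.smul_apply, smul_eq_mul]
    nlinarith [hε.1, hε.2, hσ.1 y hy]
  · have h := hφ (le_of_lt hy)
    simp only [Pi.add_apply, Pi.smul_apply, smul_eq_mul]
    nlinarith [hε.1, hε.2, hσ.2 y hy]

/-- The CDF of the uniform distribution on `[a, b]`, for `a < b`. -/
noncomputable def ramp (a b p : ℝ) : ℝ := (min p b - min p a) / (b - a)

variable {a b p : ℝ}

theorem continuous_ramp (a b : ℝ) : Continuous (ramp a b) := by
  unfold ramp
  fun_prop

theorem monotone_min_sub_min (hab : a ≤ b) : Monotone fun p : ℝ => min p b - min p a := by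
  intro p q hpq
  dsimp only
  grind

theorem monotone_ramp (hab : a ≤ b) : Monotone (ramp a b) := fun _ _ hpq =>
  div_le_div_of_nonneg_right (monotone_min_sub_min hab hpq) (sub_nonneg.2 hab)

theorem ramp_of_le (hab : a ≤ b) (hp : p ≤ a) : ramp a b p = 0 := by
  rw [ramp, min_eq_left hp, min_eq_left (hp.trans hab), sub_self, zero_div]

theorem ramp_of_ge (hab : a < b) (hp : b ≤ p) : ramp a b p = 1 := by
  rw [ramp, min_eq_right hp, min_eq_right (hab.le.trans hp), div_self (sub_pos.2 hab).ne']

theorem ramp_lt_one (hab : a < b) (hp : p < b) : ramp a b p < 1 := by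
  rw [ramp, div_lt_one (sub_pos.2 hab)]
  grind

theorem ramp_pos (hab : a < b) (hp : a < p) : 0 < ramp a b p := by
  refine div_pos ?_ (sub_pos.2 hab)
  grind

theorem monotone_inv_mul_sub_ramp (hab : a ≤ b) :
    Monotone fun p : ℝ => (b - a)⁻¹ * p - ramp a b p := by
  intro p q hpq
  have hinv : 0 ≤ (b - a)⁻¹ := inv_nonneg.2 (sub_nonneg.2 hab)
  have hincr : p - (min p b - min p a) ≤ q - (min q b - min q a) := by grind
  simpa only [ramp, div_eq_inv_mul, mul_sub] using mul_le_mul_of_nonneg_left hincr hinv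

/-- The CDF of the mixture that puts mass `τ` uniformly on `[a, b]` and mass `1 - τ` uniformly on
`[c, d]`. For `b ≤ c` its `τ`-quantiles are the points of `[b, c]`. -/
noncomputable def split (τ a b c d p : ℝ) : ℝ := τ * ramp a b p + (1 - τ) * ramp c d p

variable {τ c d v : ℝ}

theorem split_mem_distortions (hτ : τ ∈ Icc (0 : ℝ) 1) (ha : 0 ≤ a) (hab : a < b) (hbc : b ≤ c)
    (hcd : c < d) (hd : d ≤ 1) : split τ a b c d ∈ distortions := by
  refine ⟨((continuous_ramp a b).const_mul τ).add ((continuous_ramp c d).const_mul _),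
    ((monotone_ramp hab.le).const_mul hτ.1).add
      ((monotone_ramp hcd.le).const_mul (sub_nonneg.2 hτ.2)), ?_, ?_⟩
  · rw [split, ramp_of_le hab.le ha, ramp_of_le hcd.le (by linarith)]
    ring
  · rw [split, ramp_of_ge hab (by linarith), ramp_of_ge hcd hd]
    ring

theorem split_eq (hab : a < b) (hcd : c < d) (hv : v ∈ Icc b c) : split τ a b c d v = τ := by
  rw [split, ramp_of_ge hab hv.1, ramp_of_le hcd.le hv.2]
  ring

theorem crossesAt_split (hτ : τ ∈ Ioo (0 : ℝ) 1) (hav : a < v) (hvd : v < d) :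
    CrossesAt (split τ a v v d) τ v := by
  refine ⟨fun p hp => ?_, fun p hp => ?_⟩
  · rw [split, ramp_of_le hvd.le hp.le]
    nlinarith [hτ.1, ramp_lt_one hav hp]
  · rw [split, ramp_of_ge hav hp.le]
    nlinarith [hτ.2, ramp_pos hvd hp]

theorem mul_split {l : ℝ} (hab : a ≠ b) (hcd : c ≠ d) (hleft : l * τ = b - a)
    (hright : l * (1 - τ) = d - c) (p : ℝ) :
    l * split τ a b c d p = min p b - min p a + (min p d - min p c) := by
  have hba : b - a ≠ 0 := sub_ne_zero.2 hab.symm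
  have hdc : d - c ≠ 0 := sub_ne_zero.2 hcd.symm
  rw [split, mul_add, ← mul_assoc, ← mul_assoc, hleft, hright, ramp, ramp,
    mul_div_cancel₀ _ hba, mul_div_cancel₀ _ hdc]

theorem exists_monotone_mul_sub_split (hτ : τ ∈ Icc (0 : ℝ) 1) (hab : a ≤ b) (hcd : c ≤ d) :
    ∃ K : ℝ, Monotone fun p : ℝ => K * p - split τ a b c d p := by
  refine ⟨τ * (b - a)⁻¹ + (1 - τ) * (d - c)⁻¹, ?_⟩
  have h := ((monotone_inv_mul_sub_ramp hab).const_mul hτ.1).add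
    ((monotone_inv_mul_sub_ramp hcd).const_mul (sub_nonneg.2 hτ.2))
  convert h using 2 with p
  rw [split]
  ring

theorem exists_complementary_distortion {φ : ℝ → ℝ} {K : ℝ} (hφ : φ ∈ distortions)
    (hK : Monotone fun p : ℝ => K * p - φ p) :
    0 < K ∧ ∃ ψ ∈ distortions, ∀ p, φ p + K * ψ p = (1 + K) * p := by
  obtain ⟨hc, -, h0, h1⟩ := hφ
  have hK0 : 0 < K := by
    have h := hK zero_le_one
    simp only [h0, h1] at h
    linarith
  refine ⟨hK0, fun p => K⁻¹ * ((1 + K) * p - φ p), ⟨by fun_prop, ?_, by simp [h0], ?_⟩, fun p => ?_⟩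
  · convert (monotone_id.add hK).const_mul (inv_nonneg.2 hK0.le) using 3 with p
    simp only [id]
    ring
  · simp [h1, hK0.ne']
  · field_simp
    ring

theorem exists_complement_sum_split {ι : Type*} [Fintype ι] {l v : ι → ℝ}
    (hτ : τ ∈ Icc (0 : ℝ) 1) (hl : ∀ i, 0 ≤ l i) (hl_sum : ∑ i, l i = 1)
    (hv : ∀ i, v i ∈ Ioo (0 : ℝ) 1) :
    ∃ K > 0, ∃ ψ ∈ distortions, ∀ p,
      ∑ i, l i * split τ 0 (v i) (v i) 1 p + K * ψ p = (1 + K) * p := by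
  have hmean : (∑ i, l i • split τ 0 (v i) (v i) 1) ∈ distortions :=
    convex_distortions.sum_mem (fun i _ => hl i) hl_sum fun i _ =>
      split_mem_distortions hτ le_rfl (hv i).1 le_rfl (hv i).2 le_rfl
  choose k hk using fun i => exists_monotone_mul_sub_split hτ (hv i).1.le (hv i).2.le
  have hK : Monotone fun p : ℝ =>
      (∑ i, l i * k i) * p - (∑ i, l i • split τ 0 (v i) (v i) 1) p := by
    intro p q hpq
    simp only [Finset.sum_apply, Pi.smul_apply, smul_eq_mul, Finset.sum_mul,
      ← Finset.sum_sub_distrib, mul_assoc, ← mul_sub]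
    exact Finset.sum_le_sum fun i _ => mul_le_mul_of_nonneg_left (hk i hpq) (hl i)
  obtain ⟨hK_pos, ψ, hψ, hsum⟩ := exists_complementary_distortion hmean hK
  refine ⟨_, hK_pos, ψ, hψ, fun p => ?_⟩
  simpa only [Finset.sum_apply, Pi.smul_apply, smul_eq_mul] using hsum p

end Distortion

section ConcaveClosure

variable {F : ProbabilityMeasure ℝ} {w : ProbabilityMeasure ℝ → ℝ} {ι : Type*} [Fintype ι]

theorem sum_mul_le_concaveClosure {l : ι → ℝ} {G : ι → ProbabilityMeasure ℝ} (hl : ∀ i, 0 ≤ l i)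
    (hl_sum : ∑ i, l i = 1)
    (hG : ∀ y, ∑ i, l i * cdf (G i : Measure ℝ) y = cdf (F : Measure ℝ) y) :
    ((∑ i, l i * w (G i) : ℝ) : EReal) ≤ concaveClosure w F := by
  have hmem := (convex_convexHull ℝ (range fun G : ProbabilityMeasure ℝ =>
      ((cdf (G : Measure ℝ) : ℝ → ℝ), w G))).sum_mem (t := Finset.univ) (fun i _ => hl i) hl_sum
    (fun i _ => subset_convexHull _ _ (mem_range_self (G i)))
  have hcdf : ∑ i, l i • (cdf (G i : Measure ℝ) : ℝ → ℝ) = cdf (F : Measure ℝ) := by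
    funext y
    simpa only [Finset.sum_apply, Pi.smul_apply, smul_eq_mul] using hG y
  simp only [Prod.smul_mk, ← prod_mk_sum, hcdf, smul_eq_mul] at hmem
  exact le_iSup₂ (f := fun (z : ℝ) (_ : ((cdf (F : Measure ℝ) : ℝ → ℝ), z) ∈ _) => (z : EReal)) _
    hmem

variable {f : ℝ → ℝ} {τ : ℝ} {l v x : ι → ℝ} {φ : ι → ℝ → ℝ}

theorem sum_add_le_concaveClosure
    (hw : ∀ (G : ProbabilityMeasure ℝ) (x : ℝ), CrossesAt (cdf (G : Measure ℝ)) τ x → w G = f x)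
    (hl : ∀ i, 0 ≤ l i) (hφ : ∀ i, φ i ∈ distortions) (hφv : ∀ i, CrossesAt (φ i) τ (v i))
    (hx : ∀ i, CrossesAt (cdf (F : Measure ℝ)) (v i) (x i)) {m : ℝ} (hm : 0 ≤ m)
    (hl_sum : ∑ i, l i + m = 1) {R : ProbabilityMeasure ℝ}
    (hR : ∀ y, ∑ i, l i * φ i (cdf (F : Measure ℝ) y) + m * cdf (R : Measure ℝ) y =
      cdf (F : Measure ℝ) y) :
    ((∑ i, l i * f (x i) + m * w R : ℝ) : EReal) ≤ concaveClosure w F := by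
  choose G hG using fun i => exists_cdf_eq_distortion_comp F (hφ i)
  have hwG : ∀ i, w (G i) = f (x i) := fun i =>
    hw _ _ (by rw [hG]; exact (hφv i).comp (hx i))
  let l' : Option ι → ℝ := fun o => o.elim m l
  let G' : Option ι → ProbabilityMeasure ℝ := fun o => o.elim R G
  have h := sum_mul_le_concaveClosure (F := F) (w := w) (l := l') (G := G')
    (by rintro (_ | i); exacts [hm, hl i])
    (by rw [Fintype.sum_option, add_comm]; exact hl_sum)
    (fun y => by
      rw [Fintype.sum_option, add_comm, ← hR y]
      simp only [l', G', Option.elim, hG, Function.comp_apply])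
  simpa only [Fintype.sum_option, l', G', Option.elim, hwG, add_comm] using h

theorem sum_mixture_le_concaveClosure
    (hw : ∀ (G : ProbabilityMeasure ℝ) (x : ℝ), CrossesAt (cdf (G : Measure ℝ)) τ x → w G = f x)
    (hl : ∀ i, 0 ≤ l i) (hl_sum : ∑ i, l i = 1) (hφ : ∀ i, φ i ∈ distortions)
    (hφv : ∀ i, φ i (v i) = τ) (hx : ∀ i, CrossesAt (cdf (F : Measure ℝ)) (v i) (x i))
    (hsum : ∀ y, ∑ i, l i * φ i (cdf (F : Measure ℝ) y) = cdf (F : Measure ℝ) y)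
    {σ : ι → ℝ → ℝ} (hσ : ∀ i, σ i ∈ distortions) (hσv : ∀ i, CrossesAt (σ i) τ (v i))
    {K : ℝ} (hK : 0 < K) {R : ProbabilityMeasure ℝ}
    (hR : ∀ y, ∑ i, l i * σ i (cdf (F : Measure ℝ) y) + K * cdf (R : Measure ℝ) y =
      (1 + K) * cdf (F : Measure ℝ) y) {ε : ℝ} (hε : ε ∈ Ioo (0 : ℝ) 1) :
    (((1 + ε * K)⁻¹ * (∑ i, l i * f (x i) + ε * K * w R) : ℝ) : EReal) ≤ concaveClosure w F := by
  have hεK : 0 < ε * K := mul_pos hε.1 hK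
  have hpos : 0 < 1 + ε * K := by linarith
  have h := sum_add_le_concaveClosure hw (l := fun i => (1 + ε * K)⁻¹ * l i)
    (φ := fun i => (1 - ε) • φ i + ε • σ i) (m := (1 + ε * K)⁻¹ * (ε * K)) (R := R)
    (fun i => mul_nonneg (inv_nonneg.2 hpos.le) (hl i))
    (fun i => convex_distortions (hφ i) (hσ i) (sub_nonneg.2 hε.2.le) hε.1.le (by ring))
    (fun i => (hσv i).mixture (hφ i).2.1 (hφv i) hε) hx
    (mul_nonneg (inv_nonneg.2 hpos.le) hεK.le)
    (by rw [← Finset.mul_sum, hl_sum, ← mul_add, inv_mul_cancel₀ hpos.ne']) (fun y => ?_)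
  · simpa only [mul_add, Finset.mul_sum, mul_assoc] using h
  · set p := cdf (F : Measure ℝ) y
    have hmix : ∑ i, l i * ((1 - ε) • φ i + ε • σ i) p =
        (1 - ε) * ∑ i, l i * φ i p + ε * ∑ i, l i * σ i p := by
      simp only [Finset.mul_sum, ← Finset.sum_add_distrib, Pi.add_apply, Pi.smul_apply, smul_eq_mul]
      exact Finset.sum_congr rfl fun i _ => by ring
    simp only [mul_assoc, ← Finset.mul_sum]
    rw [hmix, hsum y, ← mul_add, inv_mul_eq_iff_eq_mul₀ hpos.ne']
    linear_combination ε * hR y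

-- Mixing a small multiple `ε` of a distortion that crosses `τ` strictly into each `φ i` makes all
-- the quantiles unique. The average of the `φ i` is then off by `O(ε)`, which one extra posterior
-- `R`, the same for all `ε`, makes up for; its value does not matter in the limit.
theorem sum_mul_le_concaveClosure_of_distortions (hτ : τ ∈ Ioo (0 : ℝ) 1)
    (hw : ∀ (G : ProbabilityMeasure ℝ) (x : ℝ), CrossesAt (cdf (G : Measure ℝ)) τ x → w G = f x)
    (hl : ∀ i, 0 ≤ l i) (hφ : ∀ i, φ i ∈ distortions) (hv : ∀ i, v i ∈ Ioo (0 : ℝ) 1)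
    (hφv : ∀ i, φ i (v i) = τ) (hx : ∀ i, CrossesAt (cdf (F : Measure ℝ)) (v i) (x i))
    (hsum : ∀ p ∈ Icc (0 : ℝ) 1, ∑ i, l i * φ i p = p) :
    ((∑ i, l i * f (x i) : ℝ) : EReal) ≤ concaveClosure w F := by
  have hτ' : τ ∈ Icc (0 : ℝ) 1 := Ioo_subset_Icc_self hτ
  have hl_sum : ∑ i, l i = 1 := by
    rw [← hsum 1 (right_mem_Icc.2 zero_le_one)]
    exact Finset.sum_congr rfl fun i _ => by rw [(hφ i).2.2.2, mul_one]
  obtain ⟨K, hK, ψ, hψ, hsplit⟩ := exists_complement_sum_split hτ' hl hl_sum hv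
  obtain ⟨R, hR⟩ := exists_cdf_eq_distortion_comp F hψ
  have hle : ∀ᶠ ε : ℝ in 𝓝[>] 0,
      (((1 + ε * K)⁻¹ * (∑ i, l i * f (x i) + ε * K * w R) : ℝ) : EReal) ≤ concaveClosure w F := by
    filter_upwards [Ioo_mem_nhdsGT zero_lt_one] with ε hε
    refine sum_mixture_le_concaveClosure hw hl hl_sum hφ hφv hx
      (fun y => hsum _ ⟨cdf_nonneg _ _, cdf_le_one _ _⟩)
      (fun i => split_mem_distortions hτ' le_rfl (hv i).1 le_rfl (hv i).2 le_rfl)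
      (fun i => crossesAt_split hτ (hv i).1 (hv i).2) hK (fun y => ?_) hε
    rw [hR]
    exact hsplit _
  have hlim : Tendsto (fun ε : ℝ => (1 + ε * K)⁻¹ * (∑ i, l i * f (x i) + ε * K * w R)) (𝓝[>] 0)
      (𝓝 (∑ i, l i * f (x i))) := by
    have hcont : ContinuousAt
        (fun ε : ℝ => (1 + ε * K)⁻¹ * (∑ i, l i * f (x i) + ε * K * w R)) 0 := by
      fun_prop (disch := simp)
    simpa using hcont.tendsto.mono_left nhdsWithin_le_nhds
  exact le_of_tendsto (continuous_coe_real_ereal.continuousAt.tendsto.comp hlim) hle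

theorem sum_mul_le_concaveClosure_of_split (hτ : τ ∈ Ioo (0 : ℝ) 1)
    (hw : ∀ (G : ProbabilityMeasure ℝ) (x : ℝ), CrossesAt (cdf (G : Measure ℝ)) τ x → w G = f x)
    (hl : ∀ i, 0 ≤ l i) {a b c d : ι → ℝ} (ha : ∀ i, 0 ≤ a i) (hab : ∀ i, a i < b i)
    (hv : ∀ i, v i ∈ Icc (b i) (c i)) (hcd : ∀ i, c i < d i) (hd : ∀ i, d i ≤ 1)
    (hx : ∀ i, CrossesAt (cdf (F : Measure ℝ)) (v i) (x i))
    (hsum : ∀ p ∈ Icc (0 : ℝ) 1, ∑ i, l i * split τ (a i) (b i) (c i) (d i) p = p) :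
    ((∑ i, l i * f (x i) : ℝ) : EReal) ≤ concaveClosure w F :=
  sum_mul_le_concaveClosure_of_distortions hτ hw hl
    (fun i => split_mem_distortions (Ioo_subset_Icc_self hτ) (ha i) (hab i)
      ((hv i).1.trans (hv i).2) (hcd i) (hd i))
    (fun i => ⟨((ha i).trans_lt (hab i)).trans_le (hv i).1,
      (hv i).2.trans_lt ((hcd i).trans_le (hd i))⟩)
    (fun i => split_eq (hab i) (hcd i) (hv i)) hx hsum

section Riemann

variable {h : ℝ} {α β : ℕ → ℝ} {N : ℕ}

-- Cell `j` of the lower part `[0, τ]` is paired with cell `j + 2` of the upper part `[τ, 1]`: the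
-- shift by two lets every level between `α (j + 1)` and `β (j + 2)` be a `τ`-quantile of the pair.
-- The cells left over make up one more pair, with `τ`-quantile `τ`.
theorem sum_mul_split_eq (hτ : τ ∈ Ioo (0 : ℝ) 1) (hh : 0 < h)
    (hα : ∀ j, α (j + 1) = α j + h * τ) (hα0 : α 0 = 0) (hαN : α (N + 2) = τ)
    (hβ : ∀ j, β (j + 1) = β j + h * (1 - τ)) (hβ0 : β 0 = τ) (hβN : β (N + 2) = 1) {p : ℝ}
    (hp : p ∈ Icc (0 : ℝ) 1) :
    2 * h * split τ (α N) τ τ (β 2) p +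
      ∑ j ∈ Finset.range N, h * split τ (α j) (α (j + 1)) (β (j + 2)) (β (j + 3)) p = p := by
  have hα_step : 0 < h * τ := mul_pos hh hτ.1
  have hβ_step : 0 < h * (1 - τ) := mul_pos hh (sub_pos.2 hτ.2)
  have hα_last : α N + 2 * (h * τ) = τ := by rw [hα, hα] at hαN; linarith
  have hβ_two : β 2 = τ + 2 * (h * (1 - τ)) := by rw [hβ, hβ, hβ0]; ring
  have hcell : ∀ j, h * split τ (α j) (α (j + 1)) (β (j + 2)) (β (j + 3)) p =
      (min p (α (j + 1)) - min p (α j)) + (min p (β (j + 3)) - min p (β (j + 2))) := fun j =>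
    mul_split (by rw [hα]; linarith) (by rw [hβ (j + 2)]; linarith) (by rw [hα]; ring)
      (by rw [hβ (j + 2)]; ring) p
  rw [Finset.sum_congr rfl fun j _ => hcell j, Finset.sum_add_distrib,
    Finset.sum_range_sub fun j => min p (α j), Finset.sum_range_sub fun j => min p (β (j + 2)),
    mul_split (by linarith) (by linarith) (by linarith) (by linarith), hα0, hβN,
    min_eq_right hp.1, min_eq_left hp.2]
  ring

theorem riemannSum_le_concaveClosure (hτ : τ ∈ Ioo (0 : ℝ) 1)
    (hw : ∀ (G : ProbabilityMeasure ℝ) (x : ℝ), CrossesAt (cdf (G : Measure ℝ)) τ x → w G = f x)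
    (hh : 0 < h) (hα : ∀ j, α (j + 1) = α j + h * τ) (hα0 : α 0 = 0) (hαN : α (N + 2) = τ)
    (hβ : ∀ j, β (j + 1) = β j + h * (1 - τ)) (hβ0 : β 0 = τ) (hβN : β (N + 2) = 1)
    {v x : Fin N → ℝ} (hv : ∀ j : Fin N, v j ∈ Icc (α (j + 1)) (β (j + 2)))
    (hx : ∀ j, CrossesAt (cdf (F : Measure ℝ)) (v j) (x j)) {x₀ : ℝ}
    (hx₀ : CrossesAt (cdf (F : Measure ℝ)) τ x₀) :
    ((2 * h * f x₀ + ∑ j, h * f (x j) : ℝ) : EReal) ≤ concaveClosure w F := by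
  have hα_mono : StrictMono α := strictMono_nat_of_lt_succ fun j => by
    rw [hα]; linarith [mul_pos hh hτ.1]
  have hβ_mono : StrictMono β := strictMono_nat_of_lt_succ fun j => by
    rw [hβ]; linarith [mul_pos hh (sub_pos.2 hτ.2)]
  have hα_nonneg : ∀ j, 0 ≤ α j := fun j => hα0 ▸ hα_mono.monotone (Nat.zero_le j)
  have hα_lt : α N < τ := (hα_mono (by lia)).trans_eq hαN
  have hβ_gt : τ < β 2 := hβ0.ge.trans_lt (hβ_mono two_pos)
  have hβ_le : ∀ j ≤ N + 2, β j ≤ 1 := fun j hj => (hβ_mono.monotone hj).trans_eq hβN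
  have key := sum_mul_le_concaveClosure_of_split (ι := Option (Fin N)) (F := F) hτ hw
    (l := fun o => o.elim (2 * h) fun _ => h) (v := fun o => o.elim τ v)
    (a := fun o => o.elim (α N) fun j => α j) (b := fun o => o.elim τ fun j => α (j + 1))
    (c := fun o => o.elim τ fun j => β (j + 2)) (d := fun o => o.elim (β 2) fun j => β (j + 3))
    (x := fun o => o.elim x₀ x)
    (by rintro (_ | _); exacts [(mul_pos two_pos hh).le, hh.le])
    (by rintro (_ | j); exacts [hα_nonneg N, hα_nonneg j])
    (by rintro (_ | j); exacts [hα_lt, hα_mono (Nat.lt_succ_self _)])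
    (by rintro (_ | j); exacts [left_mem_Icc.2 le_rfl, hv j])
    (by rintro (_ | j); exacts [hβ_gt, hβ_mono (Nat.lt_succ_self _)])
    (by rintro (_ | j); exacts [hβ_le 2 (by lia), hβ_le _ (by lia)])
    (by rintro (_ | j); exacts [hx₀, hx j])
    (fun p hp => by
      simp only [Fintype.sum_option, Option.elim]
      rw [Fin.sum_univ_eq_sum_range fun j : ℕ =>
        h * split τ (α j) (α (j + 1)) (β (j + 2)) (β (j + 3)) p]
      exact sum_mul_split_eq hτ hh hα hα0 hαN hβ hβ0 hβN hp)
  simpa only [Fintype.sum_option, Option.elim] using key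

end Riemann

end ConcaveClosure

section Integral

variable {g : ℝ → ℝ} {a b : ℝ}

theorem exists_intervalIntegral_le_mul (hab : a < b) (hg : IntervalIntegrable g volume a b) :
    ∃ u ∈ Ioc a b, ∫ t in a..b, g t ≤ (b - a) * g u := by
  obtain ⟨u, hu, hle⟩ := exists_setAverage_le (μ := volume) (s := Ioc a b)
    (by rw [Real.volume_Ioc]; exact (ENNReal.ofReal_pos.2 (sub_pos.2 hab)).ne')
    measure_Ioc_lt_top.ne hg.1
  refine ⟨u, hu, ?_⟩
  rwa [setAverage_eq, Real.volume_real_Ioc_of_le hab.le, smul_eq_mul,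
    inv_mul_le_iff₀ (sub_pos.2 hab), ← intervalIntegral.integral_of_le hab.le] at hle

theorem tendsto_intervalIntegral_symm_trim (hg : IntervalIntegrable g volume 0 1) :
    Tendsto (fun h : ℝ => ∫ u in h..(1 - h), g u) (𝓝[>] 0) (𝓝 (∫ u in (0 : ℝ)..1, g u)) := by
  have hcont := intervalIntegral.continuousOn_primitive_interval' hg left_mem_uIcc
  rw [uIcc_of_le zero_le_one] at hcont
  have hIcc : ∀ᶠ h : ℝ in 𝓝[>] 0, h ∈ Icc (0 : ℝ) 1 :=
    Filter.mem_of_superset (Ioo_mem_nhdsGT zero_lt_one) Ioo_subset_Icc_self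
  have hsymm : Tendsto (fun h : ℝ => 1 - h) (𝓝[>] 0) (𝓝 1) := by
    simpa using ((continuous_sub_left (1 : ℝ)).tendsto 0).mono_left nhdsWithin_le_nhds
  have hleft := (hcont 0 (left_mem_Icc.2 zero_le_one)).tendsto.comp
    (tendsto_nhdsWithin_iff.2 ⟨tendsto_id.mono_left nhdsWithin_le_nhds, hIcc⟩)
  have hright := (hcont 1 (right_mem_Icc.2 zero_le_one)).tendsto.comp
    (tendsto_nhdsWithin_iff.2 ⟨hsymm, hIcc.mono fun h hh =>
      ⟨sub_nonneg.2 hh.2, sub_le_self 1 hh.1⟩⟩)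
  have hsub := hright.sub hleft
  rw [intervalIntegral.integral_same, sub_zero] at hsub
  refine hsub.congr' (hIcc.mono fun h hh => ?_)
  have hint : ∀ t ∈ Icc (0 : ℝ) 1, IntervalIntegrable g volume 0 t := fun t ht =>
    hg.mono_set (uIcc_subset_uIcc_left (by rwa [uIcc_of_le zero_le_one]))
  exact intervalIntegral.integral_interval_sub_left
    (hint _ ⟨sub_nonneg.2 hh.2, sub_le_self 1 hh.1⟩) (hint h hh)

variable {F : ProbabilityMeasure ℝ} {w : ProbabilityMeasure ℝ → ℝ} {f X : ℝ → ℝ} {τ x₀ : ℝ}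

theorem trimmedIntegral_le_concaveClosure (hτ : τ ∈ Ioo (0 : ℝ) 1)
    (hw : ∀ (G : ProbabilityMeasure ℝ) (x : ℝ), CrossesAt (cdf (G : Measure ℝ)) τ x → w G = f x)
    (hx₀ : CrossesAt (cdf (F : Measure ℝ)) τ x₀)
    (hX : ∀ u ∈ Ioo (0 : ℝ) 1,
      ∃ v ∈ Icc (τ * u) (τ + (1 - τ) * u), CrossesAt (cdf (F : Measure ℝ)) v (X u))
    (hint : IntervalIntegrable (fun u => f (X u)) volume 0 1) {h : ℝ} (hh : 0 < h) {N : ℕ}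
    (hN : (N + 2) * h = 1) :
    ((2 * h * f x₀ + ∫ u in h..(1 - h), f (X u) : ℝ) : EReal) ≤ concaveClosure w F := by
  let s : ℕ → ℝ := fun j => (j + 1) * h
  have hs_step : ∀ j, s (j + 1) - s j = h := fun j => by simp only [s]; push_cast; ring
  have hs_mono : StrictMono s := strictMono_nat_of_lt_succ fun j => by linarith [hs_step j]
  have hs_pos : ∀ j, 0 < s j := fun j => by positivity
  have hsN : s N = 1 - h := by simp only [s]; linarith
  have hs_le : ∀ j ≤ N, s j ≤ 1 - h := fun j hj => (hs_mono.monotone hj).trans_eq hsN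
  have hs_int : ∀ j < N, IntervalIntegrable (fun u => f (X u)) volume (s j) (s (j + 1)) :=
    fun j hj => hint.mono_set (by
      rw [uIcc_of_le zero_le_one]
      exact ordConnected_Icc.uIcc_subset ⟨(hs_pos _).le, by linarith [hs_le j hj.le]⟩
        ⟨(hs_pos _).le, by linarith [hs_le _ hj]⟩)
  choose u hu hle using fun j : Fin N =>
    exists_intervalIntegral_le_mul (hs_mono (Nat.lt_succ_self j)) (hs_int j j.2)
  choose v hv hx using fun j : Fin N => hX (u j)
    ⟨(hs_pos _).trans (hu j).1, (hu j).2.trans_lt (by linarith [hs_le _ j.2])⟩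
  have hsum : ∫ u in h..(1 - h), f (X u) ≤ ∑ j, h * f (X (u j)) := by
    have hadj := intervalIntegral.sum_integral_adjacent_intervals hs_int
    rw [hsN, show s 0 = h by simp [s], ← Fin.sum_univ_eq_sum_range
      fun j => ∫ u in s j..s (j + 1), f (X u)] at hadj
    rw [← hadj]
    exact Finset.sum_le_sum fun j _ => (hle j).trans_eq (by rw [hs_step])
  refine le_trans (EReal.coe_le_coe_iff.2 (add_le_add_right hsum _))
    (riemannSum_le_concaveClosure hτ hw hh (α := fun j => τ * (j * h))
      (β := fun j => τ + (1 - τ) * (j * h)) (fun j => by push_cast; ring) (by simp) ?_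
      (fun j => by push_cast; ring) (by simp) ?_ (fun j => ?_) hx hx₀)
  · push_cast; rw [hN, mul_one]
  · push_cast; rw [hN]; ring
  · have hlo : ((j + 1 : ℕ) : ℝ) * h ≤ u j := by push_cast; exact (hu j).1.le
    have hhi : u j ≤ ((j + 2 : ℕ) : ℝ) * h :=
      (hu j).2.trans_eq (by simp only [s]; push_cast; ring)
    exact Icc_subset_Icc (mul_le_mul_of_nonneg_left hlo hτ.1.le)
      (add_le_add_right (mul_le_mul_of_nonneg_left hhi (sub_pos.2 hτ.2).le) _) (hv j)

theorem intervalIntegral_le_concaveClosure (hτ : τ ∈ Ioo (0 : ℝ) 1)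
    (hw : ∀ (G : ProbabilityMeasure ℝ) (x : ℝ), CrossesAt (cdf (G : Measure ℝ)) τ x → w G = f x)
    (hx₀ : CrossesAt (cdf (F : Measure ℝ)) τ x₀)
    (hX : ∀ u ∈ Ioo (0 : ℝ) 1,
      ∃ v ∈ Icc (τ * u) (τ + (1 - τ) * u), CrossesAt (cdf (F : Measure ℝ)) v (X u))
    (hint : IntervalIntegrable (fun u => f (X u)) volume 0 1) :
    ((∫ u in (0 : ℝ)..1, f (X u) : ℝ) : EReal) ≤ concaveClosure w F := by
  have hmesh : Tendsto (fun N : ℕ => ((N : ℝ) + 2)⁻¹) atTop (𝓝[>] 0) :=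
    tendsto_inv_atTop_nhdsGT_zero.comp
      (tendsto_atTop_add_const_right _ 2 tendsto_natCast_atTop_atTop)
  have hlim : Tendsto (fun h : ℝ => 2 * h * f x₀ + ∫ u in h..(1 - h), f (X u)) (𝓝[>] 0)
      (𝓝 (∫ u in (0 : ℝ)..1, f (X u))) := by
    have hzero : Tendsto (fun h : ℝ => 2 * h * f x₀) (𝓝[>] 0) (𝓝 0) := by
      have hcont : Continuous fun h : ℝ => 2 * h * f x₀ := by fun_prop
      simpa using (hcont.tendsto 0).mono_left nhdsWithin_le_nhds
    simpa using hzero.add (tendsto_intervalIntegral_symm_trim hint)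
  refine le_of_tendsto (continuous_coe_real_ereal.continuousAt.tendsto.comp (hlim.comp hmesh))
    (Eventually.of_forall fun N => ?_)
  exact trimmedIntegral_le_concaveClosure hτ hw hx₀ hX hint (by positivity)
    (mul_inv_cancel₀ (by positivity))

end Integral

section MonotoneInterval

variable {F P : ProbabilityMeasure ℝ} {J B : Set ℝ} {τ u : ℝ} {f : ℝ → ℝ}
  {w : ProbabilityMeasure ℝ → ℝ} {H : StieltjesFunction ℝ}

theorem exists_cdf_eq_of_mem_monotoneInterval (hτ : τ ∈ Ioo (0 : ℝ) 1)
    (hH : H ∈ monotoneInterval (rightTruncation τ F) (leftTruncation τ F)) :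
    ∃ P : ProbabilityMeasure ℝ, (P : Measure ℝ) = H.measure ∧ cdf (P : Measure ℝ) = H := by
  have hleft : Tendsto (leftTruncation τ F) atBot (𝓝 0) := by
    have h := ((tendsto_cdf_atBot (F : Measure ℝ)).const_mul (1 / τ)).min
      (tendsto_const_nhds (x := (1 : ℝ)))
    rwa [mul_zero, min_eq_left zero_le_one] at h
  have hright : Tendsto (rightTruncation τ F) atTop (𝓝 1) := by
    have h := (((tendsto_cdf_atTop (F : Measure ℝ)).sub_const τ).div_const (1 - τ)).max
      (tendsto_const_nhds (x := (0 : ℝ)))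
    rwa [div_self (sub_pos.2 hτ.2).ne', max_eq_left zero_le_one] at h
  have hbot : Tendsto H atBot (𝓝 0) :=
    tendsto_of_tendsto_of_tendsto_of_le_of_le tendsto_const_nhds hleft
      (fun x => (le_max_right _ _).trans (hH x).1) fun x => (hH x).2
  have htop : Tendsto H atTop (𝓝 1) :=
    tendsto_of_tendsto_of_tendsto_of_le_of_le hright tendsto_const_nhds
      (fun x => (hH x).1) fun x => (hH x).2.trans (min_le_right _ _)
  exact ⟨⟨H.measure, H.isProbabilityMeasure hbot htop⟩, rfl,
    cdf_measure_stieltjesFunction H hbot htop⟩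

theorem exists_crossesAt_quantile_of_mem_monotoneInterval (hF : HasFullSupportOn (F : Measure ℝ) J)
    (hJ : J.OrdConnected) (hτ : τ ∈ Ioo (0 : ℝ) 1)
    (hP : cdf (P : Measure ℝ) ∈ monotoneInterval (rightTruncation τ F) (leftTruncation τ F))
    (hu : u ∈ Ioo (0 : ℝ) 1) :
    ∃ v ∈ Icc (τ * u) (τ + (1 - τ) * u), CrossesAt (cdf (F : Measure ℝ)) v (quantile P u) := by
  refine hF.exists_crossesAt hJ hτ hu ?_ fun y hy => ?_
  · have h := ((quantile_le_iff P hu).1 le_rfl).trans ((hP _).2.trans (min_le_left _ _))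
    rwa [one_div, ← div_eq_inv_mul, le_div_iff₀' hτ.1] at h
  · have h := (le_max_left _ _).trans ((hP y).1.trans ((lt_quantile_iff P hu).1 hy).le)
    rwa [div_le_iff₀' (sub_pos.2 hτ.2), sub_le_iff_le_add'] at h

theorem setIntegral_add_le_concaveClosure (hF : HasFullSupportOn (F : Measure ℝ) J)
    (hJ : J.OrdConnected) (hτ : τ ∈ Ioo (0 : ℝ) 1)
    (hw : ∀ (G : ProbabilityMeasure ℝ) (x : ℝ), CrossesAt (cdf (G : Measure ℝ)) τ x → w G = f x)
    (hP : cdf (P : Measure ℝ) ∈ monotoneInterval (rightTruncation τ F) (leftTruncation τ F))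
    (hB : MeasurableSet B) (hint : IntegrableOn f B P) :
    ((∫ x in B, f x ∂P + (P : Measure ℝ).real Bᶜ * f (quantile F τ) : ℝ) : EReal) ≤
      concaveClosure w F := by
  classical
  have hx₀ := hF.crossesAt_quantile hJ hτ
  have hconst : IntegrableOn (fun _ => f (quantile F τ)) Bᶜ (P : Measure ℝ) := integrable_const _
  let X : ℝ → ℝ := B.piecewise id (fun _ => quantile F τ)
  have hfX : (fun x => f (X x)) = B.piecewise f fun _ => f (quantile F τ) :=
    funext fun x => apply_piecewise B _ _ fun _ => f
  have hX_int : Integrable (fun x => f (X x)) ((volume.restrict (Ioo 0 1)).map (quantile P)) := by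
    rw [map_quantile, hfX]
    exact Integrable.piecewise hB hint hconst
  have hX_quantile : ∀ u ∈ Ioo (0 : ℝ) 1, ∃ v ∈ Icc (τ * u) (τ + (1 - τ) * u),
      CrossesAt (cdf (F : Measure ℝ)) v (X (quantile P u)) := fun u hu => by
    by_cases h : quantile P u ∈ B
    · simpa only [X, piecewise_eq_of_mem _ _ _ h, id] using
        exists_crossesAt_quantile_of_mem_monotoneInterval hF hJ hτ hP hu
    · simpa only [X, piecewise_eq_of_notMem _ _ _ h] using
        ⟨τ, ⟨mul_le_of_le_one_right hτ.1.le hu.2.le,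
          le_add_of_nonneg_right (mul_nonneg (sub_pos.2 hτ.2).le hu.1.le)⟩, hx₀⟩
  have hval : ∫ u in (0 : ℝ)..1, f (X (quantile P u)) =
      ∫ x in B, f x ∂P + (P : Measure ℝ).real Bᶜ * f (quantile F τ) := by
    rw [intervalIntegral.integral_of_le zero_le_one, integral_Ioc_eq_integral_Ioo,
      ← integral_map (aemeasurable_quantile P) hX_int.aestronglyMeasurable, map_quantile, hfX,
      integral_piecewise hB hint hconst, setIntegral_const, smul_eq_mul]
  rw [← hval]
  exact intervalIntegral_le_concaveClosure hτ hw hx₀ hX_quantile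
    ((intervalIntegrable_iff_integrableOn_Ioo_of_le zero_le_one).2
      (hX_int.comp_aemeasurable (aemeasurable_quantile P)))

theorem integral_le_concaveClosure (hF : HasFullSupportOn (F : Measure ℝ) J)
    (hJ : J.OrdConnected) (hτ : τ ∈ Ioo (0 : ℝ) 1)
    (hw : ∀ (G : ProbabilityMeasure ℝ) (x : ℝ), CrossesAt (cdf (G : Measure ℝ)) τ x → w G = f x)
    (hP : cdf (P : Measure ℝ) ∈ monotoneInterval (rightTruncation τ F) (leftTruncation τ F))
    (hint : Integrable f (P : Measure ℝ)) :
    ((∫ x, f x ∂P : ℝ) : EReal) ≤ concaveClosure w F := by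
  simpa using setIntegral_add_le_concaveClosure hF hJ hτ hw hP .univ hint.integrableOn

theorem exists_lt_setIntegral_of_lintegral_ofReal_eq_top {μ : Measure ℝ} [IsFiniteMeasure μ]
    (hf : Measurable f) (htop : ∫⁻ x, ENNReal.ofReal (f x) ∂μ = ⊤) (K : ℝ) :
    ∃ B, MeasurableSet B ∧ IntegrableOn f B μ ∧ K < ∫ x in B, f x ∂μ := by
  let B : ℕ → Set ℝ := fun n => f ⁻¹' Icc 0 n
  have hB : ∀ n, MeasurableSet (B n) := fun n => hf measurableSet_Icc
  have hB_int : ∀ n, IntegrableOn f (B n) μ := fun n =>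
    .of_bound (measure_lt_top _ _) hf.aestronglyMeasurable n
      ((ae_restrict_mem (hB n)).mono fun x hx => by
        rw [Real.norm_eq_abs, abs_of_nonneg hx.1]; exact hx.2)
  have hB_mono : Monotone B := fun m n hmn =>
    preimage_mono (Icc_subset_Icc_right (Nat.cast_le.2 hmn))
  have hB_iUnion : ⋃ n, B n = f ⁻¹' Ici 0 := by
    refine subset_antisymm (iUnion_subset fun n x hx => hx.1) fun x hx => ?_
    obtain ⟨n, hn⟩ := exists_nat_ge (f x)
    exact mem_iUnion.2 ⟨n, hx, hn⟩
  have hsup : ⨆ n, ∫⁻ x in B n, ENNReal.ofReal (f x) ∂μ = ⊤ := by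
    rw [← setLIntegral_iUnion_of_directed _ hB_mono.directed_le, hB_iUnion, ← htop]
    refine setLIntegral_eq_of_support_subset fun x hx => ?_
    exact (ENNReal.ofReal_pos.1 (pos_iff_ne_zero.2 hx)).le
  obtain ⟨n, hn⟩ := lt_iSup_iff.1 (hsup ▸ ENNReal.ofReal_lt_top (r := K))
  refine ⟨B n, hB n, hB_int n, ?_⟩
  rw [← ofReal_integral_eq_lintegral_ofReal (hB_int n)
    ((ae_restrict_mem (hB n)).mono fun x hx => hx.1)] at hn
  exact lt_of_not_ge fun h => hn.not_ge (ENNReal.ofReal_le_ofReal h)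

theorem concaveClosure_eq_top (hF : HasFullSupportOn (F : Measure ℝ) J)
    (hJ : J.OrdConnected) (hτ : τ ∈ Ioo (0 : ℝ) 1)
    (hw : ∀ (G : ProbabilityMeasure ℝ) (x : ℝ), CrossesAt (cdf (G : Measure ℝ)) τ x → w G = f x)
    (hP : cdf (P : Measure ℝ) ∈ monotoneInterval (rightTruncation τ F) (leftTruncation τ F))
    (hf : Measurable f) (htop : ∫⁻ x, ENNReal.ofReal (f x) ∂P = ⊤) :
    concaveClosure w F = ⊤ := by
  refine (EReal.eq_top_iff_forall_lt _).2 fun z => ?_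
  obtain ⟨B, hB, hint, hlt⟩ := exists_lt_setIntegral_of_lintegral_ofReal_eq_top hf htop
    (z + |f (quantile F τ)|)
  refine (EReal.coe_lt_coe_iff.2 ?_).trans_le
    (setIntegral_add_le_concaveClosure hF hJ hτ hw hP hB hint)
  have hrest : -|f (quantile F τ)| ≤ (P : Measure ℝ).real Bᶜ * f (quantile F τ) := by
    refine neg_le_of_abs_le ?_
    rw [abs_mul, abs_of_nonneg measureReal_nonneg]
    exact mul_le_of_le_one_left (abs_nonneg _) measureReal_le_one
  linarith

end MonotoneInterval

section ExtIntegral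

variable {α β : Type*} [MeasurableSpace α] [MeasurableSpace β] {μ : Measure α} {f : α → ℝ}

theorem extIntegral_of_integrable (hf : Integrable f μ) :
    extIntegral f μ = ((∫ x, f x ∂μ : ℝ) : EReal) := by
  have hneg : ∫⁻ x, ENNReal.ofReal (-f x) ∂μ ≠ ⊤ := hf.neg.lintegral_lt_top.ne
  rw [extIntegral, integral_eq_lintegral_pos_part_sub_lintegral_neg_part hf, EReal.coe_sub,
    EReal.coe_ennreal_toReal hf.lintegral_lt_top.ne, EReal.coe_ennreal_toReal hneg]

theorem extIntegral_eq_bot (hf : ∫⁻ x, ENNReal.ofReal (-f x) ∂μ = ⊤) : extIntegral f μ = ⊥ := by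
  rw [extIntegral, hf, EReal.coe_ennreal_top, EReal.sub_top]

theorem integrable_of_lintegral_ofReal_ne_top (hf : AEStronglyMeasurable f μ)
    (hpos : ∫⁻ x, ENNReal.ofReal (f x) ∂μ ≠ ⊤) (hneg : ∫⁻ x, ENNReal.ofReal (-f x) ∂μ ≠ ⊤) :
    Integrable f μ := by
  have hle : ∀ x, ‖f x‖ₑ ≤ ENNReal.ofReal (f x) + ENNReal.ofReal (-f x) := fun x => by
    rw [Real.enorm_eq_ofReal_abs]
    rcases abs_choice (f x) with h | h <;> rw [h]
    · exact le_self_add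
    · exact le_add_self
  refine ⟨hf, (lintegral_mono hle).trans_lt ?_⟩
  rw [lintegral_add_left' hf.aemeasurable.ennreal_ofReal]
  exact ENNReal.add_lt_top.2 ⟨hpos.lt_top, hneg.lt_top⟩

theorem lintegral_ofReal_neg_le_add (hf : Integrable f μ) :
    ∫⁻ x, ENNReal.ofReal (-f x) ∂μ ≤
      ENNReal.ofReal (-∫ x, f x ∂μ) + ∫⁻ x, ENNReal.ofReal (f x) ∂μ := by
  have hpos := hf.lintegral_lt_top.ne
  have hneg : ∫⁻ x, ENNReal.ofReal (-f x) ∂μ ≠ ⊤ := hf.neg.lintegral_lt_top.ne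
  refine (ENNReal.ofReal_toReal hneg).ge.trans (le_trans (le_of_eq ?_)
    (ENNReal.ofReal_add_le.trans_eq (congrArg _ (ENNReal.ofReal_toReal hpos))))
  rw [integral_eq_lintegral_pos_part_sub_lintegral_neg_part hf]
  congr 1
  ring

theorem integrable_integral_measure_comp {κ : Kernel α β} {g : β → ℝ}
    (hg : Integrable g (κ ∘ₘ μ)) : Integrable (fun a => ∫ x, g x ∂(κ a)) μ := by
  rw [Measure.comp_eq_comp_const_apply] at hg
  simpa only [Kernel.const_apply] using hg.integral_comp

theorem integral_measure_comp {κ : Kernel α β} {g : β → ℝ} (hg : Integrable g (κ ∘ₘ μ)) :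
    ∫ x, g x ∂(κ ∘ₘ μ) = ∫ a, ∫ x, g x ∂(κ a) ∂μ := by
  rw [Measure.comp_eq_comp_const_apply] at hg ⊢
  rw [Kernel.integral_comp hg, Kernel.const_apply]

theorem extIntegral_comp {κ : Kernel α β} {g : β → ℝ} (hg : Measurable g)
    (hκ : ∀ a, Integrable g (κ a)) (hpos : ∫⁻ x, ENNReal.ofReal (g x) ∂(κ ∘ₘ μ) ≠ ⊤) :
    extIntegral (fun a => ∫ x, g x ∂(κ a)) μ = extIntegral g (κ ∘ₘ μ) := by
  by_cases hneg : ∫⁻ x, ENNReal.ofReal (-g x) ∂(κ ∘ₘ μ) = ⊤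
  · rw [extIntegral_eq_bot hneg]
    refine extIntegral_eq_bot (by_contra fun hne => ?_)
    rw [Measure.lintegral_bind κ.aemeasurable (by fun_prop)] at hpos
    rw [Measure.lintegral_bind κ.aemeasurable (by fun_prop)] at hneg
    have hle := lintegral_mono (μ := μ) fun a => lintegral_ofReal_neg_le_add (hκ a)
    rw [lintegral_add_right _ hg.ennreal_ofReal.lintegral_kernel] at hle
    exact (ENNReal.add_lt_top.2 ⟨Ne.lt_top hne, Ne.lt_top hpos⟩).not_ge (hneg.ge.trans hle)
  · have hint := integrable_of_lintegral_ofReal_ne_top hg.aestronglyMeasurable hpos hneg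
    rw [extIntegral_of_integrable hint, integral_measure_comp hint,
      extIntegral_of_integrable (integrable_integral_measure_comp hint)]

end ExtIntegral

section Signal

variable {F G : ProbabilityMeasure ℝ} {τ x : ℝ} {r : Kernel (ProbabilityMeasure ℝ) ℝ}
  {μ : Measure (ProbabilityMeasure ℝ)}

theorem IsQuantileSelectionRule.ae_mem (hr : IsQuantileSelectionRule τ r)
    (G : ProbabilityMeasure ℝ) : ∀ᵐ x ∂(r G), x ∈ quantileSet τ G :=
  have := hr.1
  (mem_ae_iff_prob_eq_one measurableSet_Icc).2 (hr.2 G)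

theorem IsQuantileSelectionRule.integral_eq (hr : IsQuantileSelectionRule τ r)
    (hτ : τ ∈ Ioo (0 : ℝ) 1) (hx : CrossesAt (cdf (G : Measure ℝ)) τ x) (f : ℝ → ℝ) :
    ∫ y, f y ∂(r G) = f x := by
  have := hr.1
  have hconst : f =ᵐ[r G] fun _ => f x :=
    (hr.ae_mem G).mono fun y hy => congrArg f (hx.quantileSet_subset hτ hy)
  rw [integral_congr_ae hconst, integral_const, probReal_univ, one_smul]

theorem IsQuantileSelectionRule.cdf_mem_monotoneInterval (hr : IsQuantileSelectionRule τ r)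
    (hτ : τ ∈ Ioo (0 : ℝ) 1) (G : ProbabilityMeasure ℝ) :
    cdf (r G) ∈ monotoneInterval (rightTruncation τ G) (leftTruncation τ G) := by
  have := hr.1
  have hτ' : 0 < 1 - τ := sub_pos.2 hτ.2
  refine fun x => ⟨max_le ?_ (cdf_nonneg _ _), le_min ?_ (cdf_le_one _ _)⟩
  · rcases le_or_gt (cdf (G : Measure ℝ) x) τ with h | h
    · exact (div_nonpos_of_nonpos_of_nonneg (sub_nonpos.2 h) hτ'.le).trans (cdf_nonneg _ _)
    · have hone : cdf (r G) x = 1 := by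
        rw [cdf_eq_real, measureReal_def, (mem_ae_iff_prob_eq_one measurableSet_Iic).1
          ((hr.ae_mem G).mono fun y hy => hy.2.trans (rightLim_quantile_le G hτ h)),
          ENNReal.toReal_one]
      rw [hone, div_le_one hτ']
      exact sub_le_sub_right (cdf_le_one _ _) _
  · rcases lt_or_ge (cdf (G : Measure ℝ) x) τ with h | h
    · have hzero : cdf (r G) x = 0 := by
        rw [cdf_eq_real, measureReal_eq_zero_iff]
        exact measure_eq_zero_iff_ae_notMem.2 ((hr.ae_mem G).mono fun y hy =>
          (((lt_quantile_iff G hτ).2 h).trans_le hy.1).not_ge)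
      rw [hzero]
      exact mul_nonneg (one_div_nonneg.2 hτ.1.le) (cdf_nonneg _ _)
    · rw [one_div_mul_eq_div]
      exact (cdf_le_one _ _).trans ((one_le_div hτ.1).2 h)

theorem measurable_cdf_apply (x : ℝ) :
    Measurable fun G : ProbabilityMeasure ℝ => cdf (G : Measure ℝ) x := by
  simp_rw [cdf_eq_real, measureReal_def]
  exact ((Measure.measurable_coe measurableSet_Iic).comp measurable_subtype_coe).ennreal_toReal

theorem integrable_cdf_apply (μ : Measure (ProbabilityMeasure ℝ)) [IsFiniteMeasure μ] (x : ℝ) :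
    Integrable (fun G : ProbabilityMeasure ℝ => cdf (G : Measure ℝ) x) μ :=
  .of_bound (measurable_cdf_apply x).aestronglyMeasurable 1 (Eventually.of_forall fun G => by
    rw [Real.norm_eq_abs, abs_of_nonneg (cdf_nonneg _ _)]
    exact cdf_le_one _ _)

theorem cdf_measure_comp {α : Type*} [MeasurableSpace α] {μ : Measure α} [IsProbabilityMeasure μ]
    {κ : Kernel α ℝ} [IsMarkovKernel κ] (x : ℝ) :
    Integrable (fun a => cdf (κ a) x) μ ∧ cdf (κ ∘ₘ μ) x = ∫ a, cdf (κ a) x ∂μ := by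
  have hind : ∀ (ν : Measure ℝ) [IsProbabilityMeasure ν],
      cdf ν x = ∫ y, (Iic x).indicator 1 y ∂ν := fun ν _ => by
    rw [cdf_eq_real, integral_indicator_one measurableSet_Iic]
  have hint : Integrable ((Iic x).indicator (1 : ℝ → ℝ)) (κ ∘ₘ μ) :=
    (integrable_const 1).indicator measurableSet_Iic
  simp_rw [hind]
  exact ⟨integrable_integral_measure_comp hint, integral_measure_comp hint⟩

theorem IsSignal.cdf_comp_mem_monotoneInterval (hμ : IsSignal F μ) (hτ : τ ∈ Ioo (0 : ℝ) 1)
    (hr : IsQuantileSelectionRule τ r) :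
    cdf (r ∘ₘ μ) ∈ monotoneInterval (rightTruncation τ F) (leftTruncation τ F) := by
  have := hr.1
  have := hμ.1
  refine fun x => ⟨max_le ?_ (cdf_nonneg _ _), le_min ?_ (cdf_le_one _ _)⟩
  · have h := integral_mono
      (((integrable_cdf_apply μ x).sub (integrable_const τ)).div_const (1 - τ))
      (cdf_measure_comp x).1
      fun G => (le_max_left _ _).trans (hr.cdf_mem_monotoneInterval hτ G x).1
    simp only [Pi.sub_apply] at h
    rwa [integral_div, integral_sub (integrable_cdf_apply μ x) (integrable_const τ), hμ.2,
      integral_const, probReal_univ, one_smul, ← (cdf_measure_comp x).2] at h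
  · have h := integral_mono (cdf_measure_comp x).1 ((integrable_cdf_apply μ x).const_mul (1 / τ))
      fun G => (hr.cdf_mem_monotoneInterval hτ G x).2.trans (min_le_left _ _)
    rwa [integral_const_mul, hμ.2, ← (cdf_measure_comp x).2] at h

end Signal

section FiniteSupport

variable {ι α : Type*} [Fintype ι] [MeasurableSpace α] {l : ι → ℝ} {a : ι → α} {g : α → ℝ}

theorem integrable_sum_smul_dirac (l : ι → ℝ) (a : ι → α) (hg : StronglyMeasurable g) :
    Integrable g (∑ i, ENNReal.ofReal (l i) • Measure.dirac (a i)) :=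
  integrable_finsetSum_measure.2 fun _ _ =>
    (integrable_dirac' hg enorm_lt_top).smul_measure ENNReal.ofReal_ne_top

theorem integral_sum_smul_dirac (hl : ∀ i, 0 ≤ l i) (a : ι → α) (hg : StronglyMeasurable g) :
    ∫ x, g x ∂(∑ i, ENNReal.ofReal (l i) • Measure.dirac (a i)) = ∑ i, l i * g (a i) := by
  rw [integral_finsetSum_measure fun _ _ =>
    (integrable_dirac' hg enorm_lt_top).smul_measure ENNReal.ofReal_ne_top]
  refine Finset.sum_congr rfl fun i _ => ?_
  rw [integral_smul_measure, integral_dirac' _ _ hg, ENNReal.toReal_ofReal (hl i), smul_eq_mul]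

theorem isProbabilityMeasure_sum_smul_dirac (hl : ∀ i, 0 ≤ l i) (hl_sum : ∑ i, l i = 1)
    (a : ι → α) : IsProbabilityMeasure (∑ i, ENNReal.ofReal (l i) • Measure.dirac (a i)) := by
  constructor
  simp only [Measure.finsetSum_apply, Measure.smul_apply, measure_univ, smul_eq_mul, mul_one]
  rw [← ENNReal.ofReal_sum_of_nonneg fun i _ => hl i, hl_sum, ENNReal.ofReal_one]

end FiniteSupport

section Persuasion

variable {F P : ProbabilityMeasure ℝ} {J : Set ℝ} {τ z : ℝ} {f : ℝ → ℝ}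
  {w : ProbabilityMeasure ℝ → ℝ} {r : Kernel (ProbabilityMeasure ℝ) ℝ}
  {μ : Measure (ProbabilityMeasure ℝ)}

theorem extIntegral_le_concaveClosure (hF : HasFullSupportOn (F : Measure ℝ) J)
    (hJ : J.OrdConnected) (hτ : τ ∈ Ioo (0 : ℝ) 1)
    (hw : ∀ (G : ProbabilityMeasure ℝ) (x : ℝ), CrossesAt (cdf (G : Measure ℝ)) τ x → w G = f x)
    (hP : cdf (P : Measure ℝ) ∈ monotoneInterval (rightTruncation τ F) (leftTruncation τ F))
    (hf : Measurable f) : extIntegral f (P : Measure ℝ) ≤ concaveClosure w F := by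
  by_cases hpos : ∫⁻ x, ENNReal.ofReal (f x) ∂P = ⊤
  · exact le_top.trans_eq (concaveClosure_eq_top hF hJ hτ hw hP hf hpos).symm
  by_cases hneg : ∫⁻ x, ENNReal.ofReal (-f x) ∂P = ⊤
  · exact (extIntegral_eq_bot hneg).trans_le bot_le
  have hint := integrable_of_lintegral_ofReal_ne_top hf.aestronglyMeasurable hpos hneg
  exact (extIntegral_of_integrable hint).trans_le (integral_le_concaveClosure hF hJ hτ hw hP hint)

theorem IsSignal.extIntegral_integral_le_concaveClosure (hμ : IsSignal F μ)
    (hF : HasFullSupportOn (F : Measure ℝ) J) (hJ : J.OrdConnected) (hτ : τ ∈ Ioo (0 : ℝ) 1)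
    (hr : IsQuantileSelectionRule τ r) (hf : Measurable f) (hfr : ∀ G, Integrable f (r G)) :
    extIntegral (fun G => ∫ x, f x ∂(r G)) μ ≤ concaveClosure (fun G => ∫ x, f x ∂(r G)) F := by
  have := hr.1
  have := hμ.1
  let P : ProbabilityMeasure ℝ := ⟨r ∘ₘ μ, inferInstance⟩
  have hP : cdf (P : Measure ℝ) ∈ monotoneInterval (rightTruncation τ F) (leftTruncation τ F) :=
    hμ.cdf_comp_mem_monotoneInterval hτ hr
  by_cases hpos : ∫⁻ x, ENNReal.ofReal (f x) ∂P = ⊤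
  · exact le_top.trans_eq
      (concaveClosure_eq_top hF hJ hτ (fun _ _ hx => hr.integral_eq hτ hx f) hP hf hpos).symm
  · exact (extIntegral_comp hf hfr hpos).trans_le
      (extIntegral_le_concaveClosure hF hJ hτ (fun _ _ hx => hr.integral_eq hτ hx f) hP hf)

theorem exists_isSignal_of_mem_convexHull (hf : Measurable f) (hfr : ∀ G, Integrable f (r G))
    (hz : ((cdf (F : Measure ℝ) : ℝ → ℝ), z) ∈ convexHull ℝ (range fun G : ProbabilityMeasure ℝ =>
      ((cdf (G : Measure ℝ) : ℝ → ℝ), ∫ x, f x ∂(r G)))) :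
    ∃ μ, IsSignal F μ ∧ Integrable f (r ∘ₘ μ) ∧ ∫ x, f x ∂(r ∘ₘ μ) = z := by
  obtain ⟨ι, _, l, q, hl, hl_sum, hq, hFz⟩ := mem_convexHull_iff_exists_fintype.1 hz
  choose G hG using hq
  simp only [← hG, Prod.ext_iff, Prod.fst_sum, Prod.snd_sum, Prod.smul_fst, Prod.smul_snd,
    smul_eq_mul] at hFz
  let μ : Measure (ProbabilityMeasure ℝ) := ∑ i, ENNReal.ofReal (l i) • Measure.dirac (G i)
  have hμ : IsSignal F μ := by
    refine ⟨isProbabilityMeasure_sum_smul_dirac hl hl_sum G, fun ω => ?_⟩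
    rw [integral_sum_smul_dirac hl G (measurable_cdf_apply ω).stronglyMeasurable, ← hFz.1]
    simp only [Finset.sum_apply, Pi.smul_apply, smul_eq_mul]
  have hint : Integrable f (r ∘ₘ μ) :=
    (Measure.integrable_comp_iff hf.aestronglyMeasurable).2
      ⟨Eventually.of_forall hfr,
        integrable_sum_smul_dirac l G hf.norm.stronglyMeasurable.integral_kernel⟩
  refine ⟨μ, hμ, hint, ?_⟩
  rw [integral_measure_comp hint, ← hFz.2]
  exact integral_sum_smul_dirac hl G hf.stronglyMeasurable.integral_kernel

theorem concaveClosure_le_persuasionValue (hf : Measurable f) (hfr : ∀ G, Integrable f (r G)) :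
    concaveClosure (fun G => ∫ x, f x ∂(r G)) F ≤ persuasionValue (fun G => ∫ x, f x ∂(r G)) F := by
  refine iSup₂_le fun z hz => ?_
  obtain ⟨μ, hμ, hint, rfl⟩ := exists_isSignal_of_mem_convexHull hf hfr hz
  rw [integral_measure_comp hint,
    ← extIntegral_of_integrable (integrable_integral_measure_comp hint)]
  exact le_iSup₂ (f := fun μ (_ : IsSignal F μ) => extIntegral (fun G => ∫ x, f x ∂(r G)) μ) μ hμ

theorem concaveClosure_le_iSup_extIntegral (hτ : τ ∈ Ioo (0 : ℝ) 1)
    (hr : IsQuantileSelectionRule τ r) (hf : Measurable f) (hfr : ∀ G, Integrable f (r G)) :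
    concaveClosure (fun G => ∫ x, f x ∂(r G)) F ≤
      ⨆ H ∈ monotoneInterval (rightTruncation τ F) (leftTruncation τ F),
        extIntegral f H.measure := by
  refine iSup₂_le fun z hz => ?_
  obtain ⟨μ, hμ, hint, rfl⟩ := exists_isSignal_of_mem_convexHull hf hfr hz
  have := hr.1
  have := hμ.1
  rw [← extIntegral_of_integrable hint, ← measure_cdf (r ∘ₘ μ)]
  exact le_iSup₂ (f := fun (H : StieltjesFunction ℝ)
    (_ : H ∈ monotoneInterval (rightTruncation τ F) (leftTruncation τ F)) =>
      extIntegral f H.measure) _ (hμ.cdf_comp_mem_monotoneInterval hτ hr)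

end Persuasion

theorem proposition2
    (F : ProbabilityMeasure ℝ)
    (hF : ∃ J : Set ℝ, J.OrdConnected ∧ HasFullSupportOn (F : Measure ℝ) J)
    (τ : ℝ) (hτ : τ ∈ Set.Ioo (0 : ℝ) 1)
    (r : Kernel (ProbabilityMeasure ℝ) ℝ) (hr : IsQuantileSelectionRule τ r)
    (vS : ℝ → ℝ) (hvS : Measurable vS)
    (vHat : ProbabilityMeasure ℝ → ℝ)
    (hvHat : ∀ G : ProbabilityMeasure ℝ,
      Integrable vS (r G) ∧ vHat G = ∫ x, vS x ∂(r G)) :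
    concaveClosure vHat F =
        (⨆ H ∈ monotoneInterval (rightTruncation τ F) (leftTruncation τ F),
          extIntegral vS H.measure) ∧
      persuasionValue vHat F =
        ⨆ H ∈ monotoneInterval (rightTruncation τ F) (leftTruncation τ F),
          extIntegral vS H.measure := by
  obtain ⟨J, hJ, hFJ⟩ := hF
  obtain ⟨hint, hval⟩ := forall_and.1 hvHat
  obtain rfl : vHat = fun G => ∫ x, vS x ∂(r G) := funext hval
  have hcav : concaveClosure (fun G => ∫ x, vS x ∂(r G)) F =
      ⨆ H ∈ monotoneInterval (rightTruncation τ F) (leftTruncation τ F),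
        extIntegral vS H.measure := by
    refine le_antisymm (concaveClosure_le_iSup_extIntegral hτ hr hvS hint)
      (iSup₂_le fun H hH => ?_)
    obtain ⟨P, hPH, hcdf⟩ := exists_cdf_eq_of_mem_monotoneInterval hτ hH
    rw [← hcdf] at hH
    rw [← hPH]
    exact extIntegral_le_concaveClosure hFJ hJ hτ (fun _ _ hx => hr.integral_eq hτ hx vS) hH hvS
  refine ⟨hcav, hcav ▸ le_antisymm (iSup₂_le fun μ hμ => ?_)
    (concaveClosure_le_persuasionValue hvS hint)⟩
  exact hμ.extIntegral_integral_le_concaveClosure hFJ hJ hτ hr hvS hint
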